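/- Let $E=E_\rho\oplus iE_\rho$ be a universally complete Archimedean complex vector lattice; that is, the real part $E_\rho$ is a Dedekind complete vector lattice in which every nonempty set of pairwise disjoint positive elements has a supremum, and $|f+ig|=\sup\{(\cos\theta)f+(\sin\theta)g:\theta\in[0,2\pi]\}\in E_\rho$ for $f,g\in E_\rho$. Let $E_\rho$ carry its $\Phi$-algebra multiplication ($f$-algebra multiplication with a unit $e$), extended to $E$ in the canonical way, with $z^0=e$. A sequence $(x_n)_{n\ge0}$ in $E$ converges in order to $x$, written $x_n\to x$, if there is a decreasing sequence $(p_n)$ in $E_\rho$ with $\inf_n p_n=0$ and $|x_n-x|\le p_n$ for all $n\ge 0$. A series converges in order, with sum $s$, if its partial sums converge in order to $s$. For $x,y\in E_\rho$ write $x\ll y$ if $(y-x)^+$ is a weak order unit, where $u\ge0$ is a weak order unit if $|x|\wedge u=0$ implies $x=0$. Let $S(z)=\sum_{n=0}^\infty a_nz^n$ be a power series with $a_n\in E$, and let $\Omega_S$ be the set of all $r\ge0$ in $E_\rho$ for which $S$ converges uniformly in order on $\{z\in E:|z|\le r\}$, i.e. for which there are a function $S(z)$ on this set and a decreasing sequence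 $(p_m)$ in $E_\rho$ with $\inf_m p_m=0$ such that $\left|\sum_{n=0}^m a_nz^n-S(z)\right|\le p_m$ for all $m\ge0$ and all $z$ with $|z|\le r$. Suppose that $\Omega_S$ is order bounded, that the radius of convergence $\rho_S=\sup\Omega_S$ is a weak order unit, and that the series $S(\rho_S)$ converges in order. Let $(z_k)_{k\ge0}$ be a sequence in $E$ such that (i) $z_k\to\rho_S$, (ii) $|z_k|\ll\rho_S$ for each $k\ge0$, and (iii) the set $\{|\rho_S-z_k|(\rho_S-|z_k|)^{-1}:k\ge0\}$ is order bounded. Then the series $S(z_k)$ converges in order for each $k$, and $S(z_k)\to S(\rho_S)$. -/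

import Mathlib

namespace VLSeries

/-- A real `f`-algebra: a vector lattice with an associative bilinear multiplication for which the
product of positive elements is positive and multiplication by a positive element (on either side)
preserves disjointness.  The unit of the ring makes it a `Φ`-algebra; commutativity is not part of
the definition. -/
class IsFAlgebra (A : Type*) [Ring A] [Lattice A] [Algebra ℝ A] : Prop
    extends IsOrderedAddMonoid A, IsOrderedModule ℝ A where
  mul_nonneg : ∀ x y : A, 0 ≤ x → 0 ≤ y → 0 ≤ x * y
  mul_right_inf_eq_zero : ∀ x y z : A, x ⊓ y = 0 → 0 ≤ z → (x * z) ⊓ y = 0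
  mul_left_inf_eq_zero : ∀ x y z : A, x ⊓ y = 0 → 0 ≤ z → (z * x) ⊓ y = 0

/-- Lateral completeness: every nonempty set of pairwise disjoint positive elements has a supremum.
A `ConditionallyCompleteLattice` (Dedekind complete, hence Archimedean) vector lattice with this
property is a universally complete vector lattice. -/
class IsLaterallyComplete (A : Type*) [Lattice A] [Zero A] : Prop where
  exists_isLUB : ∀ s : Set A, s.Nonempty → (∀ x ∈ s, 0 ≤ x) →
    (∀ x ∈ s, ∀ y ∈ s, x ≠ y → x ⊓ y = 0) → ∃ u : A, IsLUB s u

/-- `u` is a weak order unit: it is positive and only `0` is disjoint from it. -/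
def IsWeakOrderUnit {A : Type*} [Lattice A] [AddGroup A] (u : A) : Prop :=
  0 ≤ u ∧ ∀ x : A, |x| ⊓ u = 0 → x = 0

/-- `x ≪ y`: the positive part of `y - x` is a weak order unit. -/
def MuchLess {A : Type*} [Lattice A] [AddGroup A] (x y : A) : Prop :=
  IsWeakOrderUnit ((y - x) ⊔ 0)

/-- `p n ↓ 0`: the sequence is decreasing with infimum `0`. -/
def DecreasesToZero {A : Type*} [Lattice A] [Zero A] (p : ℕ → A) : Prop :=
  Antitone p ∧ IsGLB (Set.range p) 0

/-- A set is order bounded: it is contained in an order interval. -/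
def IsOrderBounded {A : Type*} [Preorder A] (s : Set A) : Prop :=
  ∃ u v : A, s ⊆ Set.Icc u v

/-- The complexification `A ⊕ iA`; `⟨f, g⟩` stands for `f + i g`. -/
@[ext] structure Cplx (A : Type*) where
  re : A
  im : A

namespace Cplx

variable {A : Type*}

section Ring

variable [Ring A]

instance : Zero (Cplx A) := ⟨⟨0, 0⟩⟩
instance : One (Cplx A) := ⟨⟨1, 0⟩⟩
instance : Add (Cplx A) := ⟨fun z w => ⟨z.re + w.re, z.im + w.im⟩⟩
instance : Neg (Cplx A) := ⟨fun z => ⟨-z.re, -z.im⟩⟩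
instance : Sub (Cplx A) := ⟨fun z w => ⟨z.re - w.re, z.im - w.im⟩⟩
instance : Mul (Cplx A) :=
  ⟨fun z w => ⟨z.re * w.re - z.im * w.im, z.re * w.im + z.im * w.re⟩⟩

@[simp] theorem zero_re : (0 : Cplx A).re = 0 := rfl
@[simp] theorem zero_im : (0 : Cplx A).im = 0 := rfl
@[simp] theorem one_re : (1 : Cplx A).re = 1 := rfl
@[simp] theorem one_im : (1 : Cplx A).im = 0 := rfl
@[simp] theorem add_re (z w : Cplx A) : (z + w).re = z.re + w.re := rfl
@[simp] theorem add_im (z w : Cplx A) : (z + w).im = z.im + w.im := rfl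
@[simp] theorem neg_re (z : Cplx A) : (-z).re = -z.re := rfl
@[simp] theorem neg_im (z : Cplx A) : (-z).im = -z.im := rfl
@[simp] theorem sub_re (z w : Cplx A) : (z - w).re = z.re - w.re := rfl
@[simp] theorem sub_im (z w : Cplx A) : (z - w).im = z.im - w.im := rfl
@[simp] theorem mul_re (z w : Cplx A) : (z * w).re = z.re * w.re - z.im * w.im := rfl
@[simp] theorem mul_im (z w : Cplx A) : (z * w).im = z.re * w.im + z.im * w.re := rfl

instance : Ring (Cplx A) where
  add_assoc _ _ _ := by ext <;> simp [add_assoc]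
  zero_add _ := by ext <;> simp
  add_zero _ := by ext <;> simp
  add_comm _ _ := by ext <;> simp [add_comm]
  neg_add_cancel _ := by ext <;> simp
  sub_eq_add_neg _ _ := by ext <;> simp [sub_eq_add_neg]
  nsmul := nsmulRec
  zsmul := zsmulRec
  mul_assoc _ _ _ := by ext <;> simp <;> noncomm_ring
  one_mul _ := by ext <;> simp
  mul_one _ := by ext <;> simp
  zero_mul _ := by ext <;> simp
  mul_zero _ := by ext <;> simp
  left_distrib _ _ _ := by ext <;> simp <;> noncomm_ring
  right_distrib _ _ _ := by ext <;> simp <;> noncomm_ring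

/-- The inclusion of the real part `A` in `A ⊕ iA`. -/
def ofReal (x : A) : Cplx A := ⟨x, 0⟩

end Ring

/-- The modulus `|f + i g| = sup {(cos θ) f + (sin θ) g : θ ∈ [0, 2π]}`, with values in the
real part. -/
noncomputable def modulus [ConditionallyCompleteLattice A] [Ring A] [Algebra ℝ A]
    (z : Cplx A) : A :=
  sSup ((fun θ : ℝ => Real.cos θ • z.re + Real.sin θ • z.im) '' Set.Icc 0 (2 * Real.pi))

end Cplx

section Series

variable {A : Type*} [ConditionallyCompleteLattice A] [Ring A] [Algebra ℝ A]

/-- The sequence `x` converges in order to `l`. -/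
def OrderTendsto (x : ℕ → Cplx A) (l : Cplx A) : Prop :=
  ∃ p : ℕ → A, DecreasesToZero p ∧ ∀ n, (x n - l).modulus ≤ p n

/-- The partial sum `∑_{n=0}^m a_n z^n`. -/
def partialSum (a : ℕ → Cplx A) (z : Cplx A) (m : ℕ) : Cplx A :=
  ∑ n ∈ Finset.range (m + 1), a n * z ^ n

/-- The power series `∑ a_n z^n` converges in order at the point `z`, with sum `s`. -/
def HasOrderSum (a : ℕ → Cplx A) (z s : Cplx A) : Prop :=
  OrderTendsto (partialSum a z) s

/-- The power series `∑ a_n z^n` converges uniformly in order on `D`. -/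
def ConvergesUniformlyInOrderOn (a : ℕ → Cplx A) (D : Set (Cplx A)) : Prop :=
  ∃ (S : Cplx A → Cplx A) (p : ℕ → A), DecreasesToZero p ∧
    ∀ m, ∀ z ∈ D, (partialSum a z m - S z).modulus ≤ p m

/-- The order closed ball with centre `c` and radius `r`. -/
def orderClosedBall (c : Cplx A) (r : A) : Set (Cplx A) :=
  {z | (z - c).modulus ≤ r}

/-- The set `Ω_S` of all `r ≥ 0` such that `∑ a_n z^n` converges uniformly in order on the order
closed ball with centre `0` and radius `r`. -/
def convergenceRadii (a : ℕ → Cplx A) : Set A :=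
  {r | 0 ≤ r ∧ ConvergesUniformlyInOrderOn a (orderClosedBall 0 r)}

/-- The set `Ω_S` is order bounded and `ρ = sup Ω_S` is the radius of convergence. -/
def HasRadiusOfConvergence (a : ℕ → Cplx A) (ρ : A) : Prop :=
  IsOrderBounded (convergenceRadii a) ∧ IsLUB (convergenceRadii a) ρ

end Series

end VLSeries

open VLSeries

/-! This is Abel's theorem on a Stolz region, with order estimates in place of numerical ones. A
universally complete `Φ`-algebra is commutative (`IsFAlgebra.mul_comm'`) and its weak order units
are invertible (`IsWeakOrderUnit.exists_mul_eq_one`), so one may divide by `ρ` and put `t = z k /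
ρ`, `τ = |z k| / ρ ≤ 1`. Condition (iii) then reads `|1 - t| ≤ K (1 - τ)` with one `K` for all `k`.
If `p` controls the convergence at `ρ`, summation by parts (`modulus_partialSum_sub_le`) bounds the
tails at `z k` after index `N` by `(2 + K) p N`, uniformly in `k`. Order completeness turns this
into convergence at each `z k`, with the same error bound for the sums. The sums are then compared
with `s` through a partial sum of degree `m`, which is Lipschitz. Order convergence offers no `ε`
after which `m` could be fixed, so the infimum over `m` of the resulting bounds serves as dominating
sequence (`exists_decreasesToZero_of_le_add_mul`). The algebra of the modulus rests on `|f + ig|² ≥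
f² + g²` (`normSq_le`), which is proved without square roots or a representation theorem. -/

namespace VLSeries

/-! ### Disjointness in lattice-ordered groups. -/

section LatticeOrderedGroup

variable {A : Type*} [Lattice A] [AddCommGroup A] [IsOrderedAddMonoid A]

theorem inf_add_le_inf_add_inf {g a b : A} (hg : 0 ≤ g) (ha : 0 ≤ a) (hb : 0 ≤ b) :
    g ⊓ (a + b) ≤ g ⊓ a + g ⊓ b := by
  rw [add_inf, inf_add, inf_add]
  refine le_inf (le_inf ?_ ?_) (le_inf ?_ inf_le_right)
  · exact inf_le_left.trans (le_add_of_nonneg_left hg)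
  · exact inf_le_left.trans (le_add_of_nonneg_left ha)
  · exact inf_le_left.trans (le_add_of_nonneg_right hb)

theorem inf_eq_zero_of_le {A : Type*} [Lattice A] [Zero A] {g a b : A} (hg : 0 ≤ g)
    (ha : 0 ≤ a) (hab : a ≤ b) (h : g ⊓ b = 0) : g ⊓ a = 0 :=
  le_antisymm (h ▸ inf_le_inf_left g hab) (le_inf hg ha)

theorem inf_add_eq_zero {g a b : A} (ha : g ⊓ a = 0) (hb : g ⊓ b = 0) : g ⊓ (a + b) = 0 := by
  have hg : 0 ≤ g := ha ▸ inf_le_left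
  have ha' : 0 ≤ a := ha ▸ inf_le_right
  have hb' : 0 ≤ b := hb ▸ inf_le_right
  refine le_antisymm ?_ (le_inf hg (add_nonneg ha' hb'))
  simpa [ha, hb] using inf_add_le_inf_add_inf hg ha' hb'

theorem posPart_inf_posPart_neg (x : A) : x⁺ ⊓ (-x)⁺ = 0 := by
  simpa using posPart_inf_negPart_eq_zero x

theorem posPart_sub_inf_posPart_sub (x y : A) : (x - y)⁺ ⊓ (y - x)⁺ = 0 := by
  simpa using posPart_inf_posPart_neg (x - y)

theorem add_le_of_inf_eq_zero {x y z : A} (h : x ⊓ y = 0) (hx : x ≤ z) (hy : y ≤ z) :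
    x + y ≤ z := by
  rw [← inf_add_sup x y, h, zero_add]
  exact sup_le hx hy

end LatticeOrderedGroup

/-- A Dedekind complete ordered group is Archimedean. -/
theorem nonpos_of_forall_nsmul_le {A : Type*} [ConditionallyCompleteLattice A] [AddCommGroup A]
    [IsOrderedAddMonoid A] {x y : A} (h : ∀ n : ℕ, n • x ≤ y) : x ≤ 0 := by
  have hb : BddAbove (Set.range fun n : ℕ => n • x) := ⟨y, by rintro _ ⟨n, rfl⟩; exact h n⟩
  have : sSup (Set.range fun n : ℕ => n • x) ≤ sSup (Set.range fun n : ℕ => n • x) - x := by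
    refine csSup_le (Set.range_nonempty _) ?_
    rintro _ ⟨n, rfl⟩
    rw [le_sub_iff_add_le]
    exact le_csSup hb ⟨n + 1, succ_nsmul x n⟩
  simpa using this

theorem nonpos_of_forall_le_smul {A : Type*} [ConditionallyCompleteLattice A] [AddCommGroup A]
    [IsOrderedAddMonoid A] [Module ℝ A] [IsOrderedModule ℝ A] {x y : A}
    (h : ∀ ε : ℝ, 0 < ε → x ≤ ε • y) : x ≤ 0 := by
  refine nonpos_of_forall_nsmul_le (y := y ⊔ 0) fun n => ?_
  rcases Nat.eq_zero_or_pos n with rfl | hn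
  · simp
  · have hn' : (0 : ℝ) < n := Nat.cast_pos.2 hn
    have := smul_le_smul_of_nonneg_left (h (n : ℝ)⁻¹ (by positivity)) hn'.le
    rw [smul_smul, mul_inv_cancel₀ hn'.ne', one_smul, Nat.cast_smul_eq_nsmul] at this
    exact this.trans le_sup_left

/-! ### Disjointness and products in `Φ`-algebras. -/

section FAlgebra

variable {A : Type*} [Lattice A] [Ring A] [Algebra ℝ A] [IsFAlgebra A]

/-- Multiplying one factor and then the other preserves disjointness, so `x * y` is disjoint from
itself. -/
theorem mul_eq_zero_of_inf_eq_zero {x y : A} (h : x ⊓ y = 0) : x * y = 0 := by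
  have hx : 0 ≤ x := h ▸ inf_le_left
  have hy : 0 ≤ y := h ▸ inf_le_right
  have h1 := IsFAlgebra.mul_right_inf_eq_zero x y y h hy
  have h2 := IsFAlgebra.mul_left_inf_eq_zero y (x * y) x (by rwa [inf_comm]) hx
  simpa using h2

theorem IsFAlgebra.mul_self_nonneg (x : A) : 0 ≤ x * x := by
  have h1 := mul_eq_zero_of_inf_eq_zero (posPart_inf_negPart_eq_zero x)
  have h2 := mul_eq_zero_of_inf_eq_zero ((inf_comm _ _).trans (posPart_inf_negPart_eq_zero x))
  rw [← posPart_sub_negPart x]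
  have : (x⁺ - x⁻) * (x⁺ - x⁻) = x⁺ * x⁺ + x⁻ * x⁻ := by
    rw [sub_mul, mul_sub, mul_sub, h1, h2]; abel
  rw [this]
  exact add_nonneg (IsFAlgebra.mul_nonneg _ _ (posPart_nonneg x) (posPart_nonneg x))
    (IsFAlgebra.mul_nonneg _ _ (negPart_nonneg x) (negPart_nonneg x))

instance IsFAlgebra.toIsOrderedRing : IsOrderedRing A :=
  haveI : ZeroLEOneClass A := ⟨by simpa using IsFAlgebra.mul_self_nonneg (1 : A)⟩
  IsOrderedRing.of_mul_nonneg fun a b => IsFAlgebra.mul_nonneg a b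

theorem eq_zero_of_inf_one {x : A} (h : x ⊓ 1 = 0) : x = 0 := by
  have hx : 0 ≤ x := h ▸ inf_le_left
  simpa using mul_eq_zero_of_inf_eq_zero h

theorem eq_zero_of_inf_smul_one {x : A} {ε : ℝ} (hε : 0 < ε) (h : x ⊓ ε • (1 : A) = 0) :
    x = 0 := by
  have := mul_eq_zero_of_inf_eq_zero h
  rw [mul_smul_comm, mul_one] at this
  exact (smul_eq_zero.1 this).resolve_left hε.ne'

theorem mul_nonpos_of_inf_posPart_eq_zero {g x : A} (h : g ⊓ x⁺ = 0) : g * x ≤ 0 := by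
  have hg : 0 ≤ g := h ▸ inf_le_left
  calc g * x ≤ g * x⁺ := mul_le_mul_of_nonneg_left (le_posPart x) hg
    _ = 0 := mul_eq_zero_of_inf_eq_zero h

end FAlgebra

/-! ### Commutativity of the multiplication. -/

section Commutativity

variable {A : Type*} [ConditionallyCompleteLattice A] [Ring A] [Algebra ℝ A] [IsFAlgebra A]

/-- Induction over the levels `kε`. The part of `g` under `((k+1)ε - x)⁺` is disjoint from `(kε -
x)⁺` by induction and from `(x - (k-1)ε)⁺` by the tent at `kε`. These two add up to at least `ε`,
and nothing nonzero is disjoint from a positive multiple of the unit. -/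
theorem inf_posPart_smul_one_sub_eq_zero {x g : A} {ε : ℝ} (hε : 0 < ε) (hx : 0 ≤ x) (hg : 0 ≤ g)
    (h : ∀ l : ℝ, g ⊓ (ε • (1 : A) - |x - l • (1 : A)|)⁺ = 0) (k : ℕ) :
    g ⊓ ((k * ε) • (1 : A) - x)⁺ = 0 := by
  induction k with
  | zero =>
    have : ((((0 : ℕ) : ℝ) * ε) • (1 : A) - x)⁺ = 0 := by simpa using hx
    rw [this, inf_eq_right.2 hg]
  | succ k ih =>
    set a := ((k * ε) • (1 : A) - x)⁺ with ha
    set b := (x - ((k - 1) * ε) • (1 : A))⁺ with hb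
    set c := (((k + 1 : ℕ) * ε) • (1 : A) - x)⁺ with hc
    have hbc : b ⊓ c ≤ (ε • (1 : A) - |x - (k * ε) • (1 : A)|)⁺ := by
      have hd : b ⊓ c =
          ((x - ((k - 1) * ε) • (1 : A)) ⊓ (((k + 1 : ℕ) * ε) • (1 : A) - x))⁺ :=
        letI := AddCommGroup.toDistribLattice A
        (sup_inf_right _ _ _).symm
      rw [hd]
      refine posPart_mono (le_sub_comm.1 (abs_le'.2 ⟨?_, ?_⟩))
      · refine le_sub_comm.1 (inf_le_right.trans (le_of_eq ?_))
        push_cast; module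
      · refine le_sub_comm.1 (inf_le_left.trans (le_of_eq ?_))
        module
    have hb0 : 0 ≤ b := posPart_nonneg _
    have hc0 : 0 ≤ c := posPart_nonneg _
    have ha0 : 0 ≤ a := posPart_nonneg _
    have hq0 : 0 ≤ g ⊓ c := le_inf hg hc0
    have h1 : (g ⊓ c) ⊓ b = 0 := by
      rw [inf_assoc, inf_comm c b]
      exact inf_eq_zero_of_le hg (le_inf hb0 hc0) hbc (h _)
    have h2 : (g ⊓ c) ⊓ a = 0 :=
      le_antisymm (ih ▸ inf_le_inf_right a inf_le_left) (le_inf hq0 ha0)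
    have h3 := inf_add_eq_zero h2 h1
    refine eq_zero_of_inf_smul_one hε (inf_eq_zero_of_le hq0 (smul_nonneg hε.le zero_le_one) ?_ h3)
    calc ε • (1 : A) = ((k * ε) • (1 : A) - x) + (x - ((k - 1) * ε) • (1 : A)) := by module
      _ ≤ a + b := add_le_add (le_posPart _) (le_posPart _)

/-- The tents `(ε - |x - l|)⁺` have no common disjoint element. -/
theorem eq_zero_of_forall_inf_tent {x g : A} {ε : ℝ} (hε : 0 < ε) (hx : 0 ≤ x) (hg : 0 ≤ g)
    (h : ∀ l : ℝ, g ⊓ (ε • (1 : A) - |x - l • (1 : A)|)⁺ = 0) : g = 0 := by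
  have key : ε • g ≤ 0 := by
    refine nonpos_of_forall_nsmul_le (y := g * x) fun k => ?_
    have := mul_nonpos_of_inf_posPart_eq_zero (inf_posPart_smul_one_sub_eq_zero hε hx hg h k)
    rw [mul_sub, sub_nonpos, mul_smul_comm, mul_one, mul_smul, Nat.cast_smul_eq_nsmul] at this
    exact this
  have h0 : ε • g = 0 := le_antisymm key (smul_nonneg hε.le hg)
  exact (smul_eq_zero.1 h0).resolve_left hε.ne'

theorem abs_mul_sub_mul_le {x y : A} (hy : 0 ≤ y) :
    |y * x - x * y| ≤ y * |x| + |x| * y := by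
  refine abs_le'.2 ⟨?_, ?_⟩
  · rw [sub_eq_add_neg, ← neg_mul]
    exact add_le_add (mul_le_mul_of_nonneg_left (le_abs_self x) hy)
      (mul_le_mul_of_nonneg_right (neg_le_abs x) hy)
  · rw [neg_sub, sub_eq_neg_add, ← mul_neg]
    exact add_le_add (mul_le_mul_of_nonneg_left (neg_le_abs x) hy)
      (mul_le_mul_of_nonneg_right (le_abs_self x) hy)

/-- Replacing `x` by `x - l` leaves the commutator unchanged. Where `|x - l| < ε` it is therefore at
most `2εy`, and such regions, over all real `l`, leave no room for an excess. -/
theorem abs_commutator_le {x y : A} (hx : 0 ≤ x) (hy : 0 ≤ y) {ε : ℝ} (hε : 0 < ε) :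
    |y * x - x * y| ≤ (2 * ε) • y := by
  suffices (|y * x - x * y| - (2 * ε) • y)⁺ = 0 by simpa using this
  refine eq_zero_of_forall_inf_tent hε hx (posPart_nonneg _) fun l => ?_
  set B := |x - l • (1 : A)| with hB
  have hdisj := posPart_sub_inf_posPart_sub B (ε • (1 : A))
  have h1 := IsFAlgebra.mul_left_inf_eq_zero _ _ y hdisj hy
  have h2 := IsFAlgebra.mul_right_inf_eq_zero _ _ y hdisj hy
  rw [inf_comm] at h1 h2 ⊢
  refine inf_eq_zero_of_le (posPart_nonneg _) (posPart_nonneg _) ?_ (inf_add_eq_zero h1 h2)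
  have hp : 0 ≤ (B - ε • (1 : A))⁺ := posPart_nonneg _
  refine sup_le ?_ (add_nonneg (mul_nonneg hy hp) (mul_nonneg hp hy))
  have hD : y * x - x * y = y * (x - l • (1 : A)) - (x - l • (1 : A)) * y := by
    simp [mul_sub, sub_mul]
  calc |y * x - x * y| - (2 * ε) • y ≤ y * B + B * y - (2 * ε) • y := by
        rw [hD]; exact sub_le_sub_right (abs_mul_sub_mul_le hy) _
    _ = y * (B - ε • (1 : A)) + (B - ε • (1 : A)) * y := by
        rw [mul_sub, sub_mul, mul_smul_comm, smul_mul_assoc, mul_one, one_mul]; module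
    _ ≤ _ := add_le_add (mul_le_mul_of_nonneg_left (le_posPart _) hy)
        (mul_le_mul_of_nonneg_right (le_posPart _) hy)

theorem IsFAlgebra.mul_comm_of_nonneg {x y : A} (hx : 0 ≤ x) (hy : 0 ≤ y) : y * x = x * y := by
  have h : |y * x - x * y| ≤ 0 := by
    refine nonpos_of_forall_le_smul (y := y) fun ε hε => ?_
    simpa [mul_div_cancel₀] using abs_commutator_le hx hy (half_pos hε)
  refine le_antisymm (sub_nonpos.1 ((le_abs_self _).trans h)) (sub_nonpos.1 ?_)
  simpa using (neg_le_abs _).trans h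

/-- Dedekind complete `Φ`-algebras are commutative. -/
theorem IsFAlgebra.mul_comm' (x y : A) : x * y = y * x := by
  rw [← posPart_sub_negPart x, ← posPart_sub_negPart y]
  have h := fun {a b : A} (ha : 0 ≤ a) (hb : 0 ≤ b) => IsFAlgebra.mul_comm_of_nonneg hb ha
  simp only [mul_sub, sub_mul, h (posPart_nonneg x) (posPart_nonneg y),
    h (posPart_nonneg x) (negPart_nonneg y), h (negPart_nonneg x) (posPart_nonneg y),
    h (negPart_nonneg x) (negPart_nonneg y)]
  abel

end Commutativity

/-! ### Absence of nilpotents and comparison of squares. -/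

section Semiprime

variable {A : Type*} [ConditionallyCompleteLattice A] [CommRing A] [Algebra ℝ A] [IsFAlgebra A]

/-- The square `(1 - nd)² = 1 - 2nd` is nonnegative for every `n`, so the Archimedean property
applies. -/
theorem nonpos_of_mul_self_eq_zero {d : A} (h : d * d = 0) : d ≤ 0 := by
  have h2 : (2 : ℝ) • d ≤ 0 := by
    refine nonpos_of_forall_nsmul_le (y := (1 : A)) fun n => ?_
    have h1 := IsFAlgebra.mul_self_nonneg (1 - (n : A) * d)
    have h3 : (1 - (n : A) * d) * (1 - n * d) = 1 - n • (2 : ℝ) • d := by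
      rw [two_smul, nsmul_eq_mul]
      linear_combination (n : A) * n * h
    exact sub_nonneg.1 (h3 ▸ h1)
  have := smul_le_smul_of_nonneg_left h2 (show (0 : ℝ) ≤ 2⁻¹ by norm_num)
  simpa [smul_smul] using this

theorem eq_zero_of_mul_self_eq_zero {d : A} (h : d * d = 0) : d = 0 :=
  le_antisymm (nonpos_of_mul_self_eq_zero h)
    (neg_nonpos.1 (nonpos_of_mul_self_eq_zero (by simpa using h)))

theorem inf_eq_zero_of_mul_eq_zero {x y : A} (hx : 0 ≤ x) (hy : 0 ≤ y) (h : x * y = 0) :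
    x ⊓ y = 0 := by
  have h0 : 0 ≤ x ⊓ y := le_inf hx hy
  refine eq_zero_of_mul_self_eq_zero (le_antisymm ?_ (mul_nonneg h0 h0))
  exact (mul_le_mul inf_le_left inf_le_right h0 hx).trans h.le

theorem posPart_mul_self (x : A) : x⁺ * x = x⁺ * x⁺ := by
  have h1 := mul_eq_zero_of_inf_eq_zero (posPart_inf_negPart_eq_zero x)
  have h2 := posPart_sub_negPart x
  linear_combination -x⁺ * h2 - h1

/-- With `d = (x - y)⁺` one has `d (x² - y²) = d³ + 2d²y`, so `d³` vanishes. This replaces taking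
square roots. -/
theorem le_of_mul_self_le_mul_self {x y : A} (hy : 0 ≤ y) (h : x * x ≤ y * y) : x ≤ y := by
  suffices (x - y)⁺ = 0 by simpa using this
  set d := (x - y)⁺ with hd
  have hd0 : 0 ≤ d := posPart_nonneg _
  have h1 : d * (x - y) = d * d := posPart_mul_self _
  have h2 : d * (x * x - y * y) = d * d * d + 2 * (d * d * y) := by
    linear_combination (d + 2 * y) * h1 + (x - y) * h1
  have h3 : d * (x * x - y * y) ≤ 0 :=
    mul_nonpos_of_nonneg_of_nonpos hd0 (sub_nonpos.2 h)
  have h4 : d * d * d = 0 := by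
    refine le_antisymm (le_trans ?_ (h2 ▸ h3)) (mul_nonneg (mul_nonneg hd0 hd0) hd0)
    have h6 : 0 ≤ d * d * y := mul_nonneg (mul_nonneg hd0 hd0) hy
    rw [two_mul]
    exact le_add_of_nonneg_right (add_nonneg h6 h6)
  have h5 : d * d = 0 := eq_zero_of_mul_self_eq_zero (by linear_combination d * h4)
  exact eq_zero_of_mul_self_eq_zero h5

end Semiprime

/-! ### Components of the unit. -/

section Support

variable {A : Type*} [ConditionallyCompleteLattice A] [Ring A]

/-- The component of the unit generated by `y`. -/
noncomputable def supp (y : A) : A := sSup (Set.range fun m : ℕ => (1 : A) ⊓ m • y)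

theorem bddAbove_supp (y : A) : BddAbove (Set.range fun m : ℕ => (1 : A) ⊓ m • y) :=
  ⟨1, by rintro _ ⟨m, rfl⟩; exact inf_le_left⟩

theorem le_supp (y : A) (m : ℕ) : (1 : A) ⊓ m • y ≤ supp y :=
  le_csSup (bddAbove_supp y) ⟨m, rfl⟩

theorem supp_le {y b : A} (h : ∀ m : ℕ, (1 : A) ⊓ m • y ≤ b) : supp y ≤ b :=
  csSup_le (Set.range_nonempty _) (by rintro _ ⟨m, rfl⟩; exact h m)

theorem supp_le_one (y : A) : supp y ≤ 1 := supp_le fun _ => inf_le_left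

variable [Algebra ℝ A] [IsFAlgebra A]

theorem supp_nonneg (y : A) : 0 ≤ supp y := by simpa using le_supp y 0

theorem supp_mono {x y : A} (h : x ≤ y) : supp x ≤ supp y :=
  supp_le fun m => (inf_le_inf_left _ (nsmul_le_nsmul_right h m)).trans (le_supp y m)

theorem supp_zero : supp (0 : A) = 0 :=
  le_antisymm (supp_le fun m => by simp) (supp_nonneg 0)

theorem inf_nsmul_eq_zero {g y : A} (h : g ⊓ y = 0) (m : ℕ) : g ⊓ m • y = 0 := by
  induction m with
  | zero => rw [zero_smul, inf_eq_right]; exact h ▸ inf_le_left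
  | succ m ih => rw [succ_nsmul]; exact inf_add_eq_zero ih h

theorem inf_supp_eq_zero {g y : A} (h : g ⊓ y = 0) : g ⊓ supp y = 0 := by
  have hg : 0 ≤ g := h ▸ inf_le_left
  have hy : 0 ≤ y := h ▸ inf_le_right
  have h0 : 0 ≤ g ⊓ supp y := le_inf hg (supp_nonneg y)
  refine le_antisymm ?_ h0
  have : supp y ≤ supp y - g ⊓ supp y := by
    refine supp_le fun m => le_sub_iff_add_le.2 ?_
    refine add_le_of_inf_eq_zero ?_ (le_supp y m) inf_le_right
    have hm : 0 ≤ (1 : A) ⊓ m • y := le_inf zero_le_one (nsmul_nonneg hy m)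
    rw [inf_comm]
    refine inf_eq_zero_of_le h0 hm inf_le_right ?_
    rw [inf_comm]
    refine inf_eq_zero_of_le (nsmul_nonneg hy m) h0 inf_le_left ?_
    rw [inf_comm]
    exact inf_nsmul_eq_zero h m
  simpa using this

/-- Adding `y ⊓ (1 - supp y)` to `1 ⊓ m • y` stays below `1 ⊓ (m + 1) • y` or its supremum `supp y`,
so the added element must vanish. -/
theorem inf_one_sub_supp_eq_zero {y : A} (hy : 0 ≤ y) : y ⊓ (1 - supp y) = 0 := by
  refine le_antisymm ?_ (le_inf hy (sub_nonneg.2 (supp_le_one y)))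
  have : supp y ≤ supp y - y ⊓ (1 - supp y) := by
    refine supp_le fun m => le_sub_iff_add_le.2 (le_trans (le_inf ?_ ?_) (le_supp y (m + 1)))
    · calc (1 : A) ⊓ m • y + y ⊓ (1 - supp y) ≤ supp y + (1 - supp y) :=
            add_le_add (le_supp y m) inf_le_right
        _ = 1 := by abel
    · rw [succ_nsmul]
      exact add_le_add inf_le_right inf_le_left
  simpa using this

end Support

theorem DecreasesToZero.nonneg {A : Type*} [Lattice A] [Zero A] {p : ℕ → A}
    (hp : DecreasesToZero p) (n : ℕ) : 0 ≤ p n :=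
  hp.2.1 ⟨n, rfl⟩

/-! ### Inverses of weak order units. -/

section Inverse

variable {A : Type*} [ConditionallyCompleteLattice A] [CommRing A] [Algebra ℝ A] [IsFAlgebra A]

theorem eq_zero_of_mul_weakOrderUnit {u x : A} (hu : IsWeakOrderUnit u) (hx : 0 ≤ x)
    (h : x * u = 0) : x = 0 :=
  hu.2 x (by rw [abs_of_nonneg hx]; exact inf_eq_zero_of_mul_eq_zero hx hu.1 h)

theorem le_of_mul_le_mul_weakOrderUnit {u x y : A} (hu : IsWeakOrderUnit u)
    (h : u * x ≤ u * y) : x ≤ y := by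
  suffices (x - y)⁺ = 0 by simpa using this
  have hd := posPart_nonneg (x - y)
  have h1 : (x - y)⁺ * (x - y)⁺ * u = 0 := by
    refine le_antisymm ?_ (mul_nonneg (mul_nonneg hd hd) hu.1)
    have : (x - y)⁺ * (x - y)⁺ * u = (x - y)⁺ * (u * x - u * y) := by
      rw [← posPart_mul_self]; ring
    rw [this]
    exact mul_nonpos_of_nonneg_of_nonpos hd (sub_nonpos.2 h)
  exact eq_zero_of_mul_self_eq_zero (eq_zero_of_mul_weakOrderUnit hu (mul_nonneg hd hd) h1)

theorem mul_posPart_one_sub_smul_le {s : A} (hs : 0 ≤ s) : s * (1 - s)⁺ ≤ 1 := by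
  have h0 := posPart_nonneg (1 - s)
  have h1 := IsFAlgebra.mul_self_nonneg (1 - s)⁺
  have h2 : s * (1 - s)⁺ = (1 - s)⁺ - (1 - s)⁺ * (1 - s)⁺ := by
    rw [← posPart_mul_self]; ring
  rw [h2]
  refine (sub_le_self _ h1).trans (sup_le (sub_le_self _ hs) zero_le_one)

theorem eq_zero_of_forall_mul_posPart {u w : A} (hw : 0 ≤ w)
    (h : ∀ t : ℝ, 0 < t → t • ((1 - t • u)⁺ * w) ≤ 0) : w = 0 := by
  refine le_antisymm (nonpos_of_forall_le_smul (y := u * w) fun t ht => ?_) hw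
  have h1 : (1 - t • u)⁺ * w ≤ 0 := by
    have := smul_le_smul_of_nonneg_left (h t ht) (inv_nonneg.2 ht.le)
    rwa [smul_smul, inv_mul_cancel₀ ht.ne', one_smul, smul_zero] at this
  have h2 : (1 - t • u) * w ≤ 0 := (mul_le_mul_of_nonneg_right (le_posPart _) hw).trans h1
  rwa [sub_mul, one_mul, smul_mul_assoc, sub_nonpos] at h2

/-- The inverse is the largest `x` with `u * x ≤ 1`; `W` bounds these `x`. For `w ≥ 0` the element
`t(1 - tu)⁺w` has product with `u` at most `w`: subtracting it with `w = (uv - 1)⁺` still leaves an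
upper bound, adding it with `w = 1 - uv` stays in the set. Either way it is zero for all `t > 0`,
which forces `w = 0`. -/
theorem exists_mul_eq_one_of_one_le_mul {u W : A} (hu : IsWeakOrderUnit u) (hW : 1 ≤ u * W) :
    ∃ v : A, 0 ≤ v ∧ u * v = 1 := by
  let S : Set A := {x | u * x ≤ 1}
  have hS : BddAbove S := ⟨W, fun x hx => le_of_mul_le_mul_weakOrderUnit hu (le_trans hx hW)⟩
  have h0S : (0 : A) ∈ S := by simp [S]
  set v := sSup S with hv
  have hv0 : 0 ≤ v := le_csSup hS h0S
  have small : ∀ {w : A} {t : ℝ}, 0 ≤ w → 0 < t → u * (t • ((1 - t • u)⁺ * w)) ≤ w := by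
    intro w t hw ht
    have := mul_le_mul_of_nonneg_right
      (mul_posPart_one_sub_smul_le (smul_nonneg ht.le hu.1)) hw
    rw [one_mul] at this
    refine le_trans (le_of_eq ?_) this
    simp only [Algebra.smul_def]; ring
  have hle : u * v ≤ 1 := by
    suffices (u * v - 1)⁺ = 0 by simpa using this
    refine eq_zero_of_forall_mul_posPart (u := u) (posPart_nonneg _) fun t ht => ?_
    have : v ≤ v - t • ((1 - t • u)⁺ * (u * v - 1)⁺) := by
      refine csSup_le ⟨0, h0S⟩ fun x hx => ?_
      refine le_sub_comm.1 (le_of_mul_le_mul_weakOrderUnit hu ?_)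
      refine (small (posPart_nonneg _) ht).trans (sup_le ?_ ?_)
      · rw [mul_sub]; exact sub_le_sub_left hx _
      · exact mul_nonneg hu.1 (sub_nonneg.2 (le_csSup hS hx))
    simpa using this
  refine ⟨v, hv0, (sub_eq_zero.1 ?_).symm⟩
  refine eq_zero_of_forall_mul_posPart (u := u) (sub_nonneg.2 hle) fun t ht => ?_
  have hmem : v + t • ((1 - t • u)⁺ * (1 - u * v)) ∈ S := by
    have := small (sub_nonneg.2 hle) ht
    change u * _ ≤ 1
    rw [mul_add]
    exact (add_le_add_right this _).trans (le_of_eq (by abel))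
  exact (add_le_iff_nonpos_right v).1 (le_csSup hS hmem)

/-- The unit is cut into disjoint layers `d n` on which `u ≥ 1/(n+1)`, and `W` equals `n + 1` on the
layer `d n`. Lateral completeness is what makes this unbounded gluing possible. -/
theorem exists_one_le_mul [IsLaterallyComplete A] {u : A} (hu : IsWeakOrderUnit u) :
    ∃ W : A, 1 ≤ u * W := by
  let y : ℕ → A := fun n => (n • u - 1)⁺
  let e : ℕ → A := fun n => supp (y n)
  let d : ℕ → A := fun n => e (n + 1) - e n
  have hy0 : ∀ n, 0 ≤ y n := fun n => posPart_nonneg _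
  have ymono : Monotone y := fun m n h =>
    posPart_mono (sub_le_sub_right (nsmul_le_nsmul_left hu.1 h) _)
  have emono : Monotone e := fun m n h => supp_mono (ymono h)
  have he0 : e 0 = 0 := by
    have : y 0 = 0 := by simp [y]
    simp [e, this, supp_zero]
  have hd0 : ∀ n, 0 ≤ d n := fun n => sub_nonneg.2 (emono n.le_succ)
  have hen : ∀ n, 0 ≤ e n := fun n => supp_nonneg _
  have he1 : ∀ n, 0 ≤ 1 - e n := fun n => sub_nonneg.2 (supp_le_one _)
  have hcomp : ∀ n, (1 - e n) ⊓ e n = 0 := fun n =>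
    inf_supp_eq_zero ((inf_comm _ _).trans (inf_one_sub_supp_eq_zero (hy0 n)))
  have hdle : ∀ n, d n ≤ e (n + 1) := fun n => sub_le_self _ (hen n)
  have hdle' : ∀ n, d n ≤ 1 - e n := fun n => sub_le_sub_right (supp_le_one _) _
  have hed : ∀ {m n}, m ≤ n → e m ⊓ d n = 0 := fun {m n} h => by
    refine inf_eq_zero_of_le (hen m) (hd0 n) (hdle' n) ?_
    rw [inf_comm]
    exact inf_eq_zero_of_le (he1 n) (hen m) (emono h) (hcomp n)
  have hdd : ∀ {m n}, m < n → d m ⊓ d n = 0 := fun {m n} h => by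
    rw [inf_comm]
    exact inf_eq_zero_of_le (hd0 n) (hd0 m) (hdle m) ((inf_comm _ _).trans (hed h))
  let c : ℕ → A := fun n => (n + 1) • d n
  have hcc : ∀ {m n}, m < n → c m ⊓ c n = 0 := fun {m n} h => by
    refine inf_nsmul_eq_zero ?_ _
    rw [inf_comm]
    refine inf_nsmul_eq_zero ?_ _
    rw [inf_comm]
    exact hdd h
  obtain ⟨W, hW⟩ := IsLaterallyComplete.exists_isLUB (Set.range c) (Set.range_nonempty _)
    (by rintro _ ⟨n, rfl⟩; exact nsmul_nonneg (hd0 n) _)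
    (by
      rintro _ ⟨m, rfl⟩ _ ⟨n, rfl⟩ hne
      rcases lt_trichotomy m n with h | rfl | h
      · exact hcc h
      · exact absurd rfl hne
      · rw [inf_comm]; exact hcc h)
  have hud : ∀ n, d n ≤ u * W := by
    intro n
    have h1 : d n ⊓ (1 - (n + 1) • u)⁺ = 0 := by
      rw [inf_comm]
      refine inf_eq_zero_of_le (posPart_nonneg _) (hd0 n) (hdle n) (inf_supp_eq_zero ?_)
      exact posPart_sub_inf_posPart_sub _ _
    have h2 := mul_nonpos_of_inf_posPart_eq_zero h1
    have h3 : d n * (1 - (n + 1) • u) = d n - u * c n := by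
      simp only [c, nsmul_eq_mul]; ring
    rw [h3, sub_nonpos] at h2
    exact h2.trans (mul_le_mul_of_nonneg_left (hW.1 ⟨n, rfl⟩) hu.1)
  have heW : ∀ n, e n ≤ u * W := by
    intro n
    induction n with
    | zero => rw [he0]; exact (hd0 0).trans (hud 0)
    | succ n ih =>
      have := add_le_of_inf_eq_zero (hed le_rfl) ih (hud n)
      simpa [d] using this
  refine ⟨W, ?_⟩
  suffices (1 - u * W)⁺ = 0 by simpa using this
  have hh := posPart_nonneg (1 - u * W)
  -- The layers exhaust the unit: what they miss is disjoint from every `(n • u - 1)⁺`, so its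
  -- product with `n • u` is bounded independently of `n`.
  refine eq_zero_of_mul_weakOrderUnit hu hh (le_antisymm ?_ (mul_nonneg hh hu.1))
  refine nonpos_of_forall_nsmul_le (y := (1 - u * W)⁺) fun n => ?_
  have h1 : (1 - u * W)⁺ ≤ 1 - e n := sup_le (sub_le_sub_left (heW n) _) (he1 n)
  have h2 : (1 - u * W)⁺ ⊓ (n • u - 1)⁺ = 0 := by
    rw [inf_comm]
    exact inf_eq_zero_of_le (hy0 n) hh h1 (inf_one_sub_supp_eq_zero (hy0 n))
  have h3 := mul_nonpos_of_inf_posPart_eq_zero h2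
  rwa [mul_sub, mul_one, sub_nonpos, mul_smul_comm] at h3

theorem IsWeakOrderUnit.exists_mul_eq_one [IsLaterallyComplete A] {u : A}
    (hu : IsWeakOrderUnit u) : ∃ v : A, 0 ≤ v ∧ u * v = 1 :=
  let ⟨_, hW⟩ := exists_one_le_mul hu
  exists_mul_eq_one_of_one_le_mul hu hW

theorem isWeakOrderUnit_of_one_le {y : A} (hy : 1 ≤ y) : IsWeakOrderUnit y := by
  refine ⟨zero_le_one.trans hy, fun x hx => ?_⟩
  have h := eq_zero_of_inf_one (inf_eq_zero_of_le (abs_nonneg x) zero_le_one hy hx)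
  exact le_antisymm ((le_abs_self x).trans h.le) (neg_nonpos.1 ((neg_le_abs x).trans h.le))

/-- Enlarging `c` to `c ⊔ 1` gives an invertible factor, which can be divided out of any lower
bound. -/
theorem DecreasesToZero.mul_left {p : ℕ → A} (hp : DecreasesToZero p) {c : A} (hc : 0 ≤ c) :
    DecreasesToZero fun n => c * p n := by
  refine ⟨fun m n h => mul_le_mul_of_nonneg_left (hp.1 h) hc, ?_, fun w hw => ?_⟩
  · rintro _ ⟨n, rfl⟩
    exact mul_nonneg hc (hp.nonneg n)
  · have hy : (1 : A) ≤ c ⊔ 1 := le_sup_right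
    have hu := isWeakOrderUnit_of_one_le hy
    obtain ⟨v, hv0, hv⟩ := exists_mul_eq_one_of_one_le_mul (W := 1) hu (by simp)
    refine le_of_mul_le_mul_weakOrderUnit (u := v) ⟨hv0, fun x hx => ?_⟩ ?_
    · have h := mul_eq_zero_of_inf_eq_zero hx
      have h' : |x| = 0 := by linear_combination (c ⊔ 1) * h - |x| * hv
      exact le_antisymm ((le_abs_self x).trans h'.le) (neg_nonpos.1 ((neg_le_abs x).trans h'.le))
    · rw [mul_zero]
      refine hp.2.2 ?_
      rintro _ ⟨n, rfl⟩
      have h1 : w ≤ (c ⊔ 1) * p n :=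
        (hw ⟨n, rfl⟩).trans (mul_le_mul_of_nonneg_right le_sup_left (hp.nonneg n))
      refine (mul_le_mul_of_nonneg_left h1 hv0).trans (le_of_eq ?_)
      linear_combination p n * hv

end Inverse

/-! ### The modulus and its submultiplicativity. -/

theorem Cplx.modulus_le {A : Type*} [ConditionallyCompleteLattice A] [Ring A] [Algebra ℝ A]
    {z : Cplx A} {b : A} (h : ∀ θ : ℝ, Real.cos θ • z.re + Real.sin θ • z.im ≤ b) :
    z.modulus ≤ b :=
  csSup_le ((Set.nonempty_Icc.2 (by positivity)).image _) (by rintro _ ⟨θ, -, rfl⟩; exact h θ)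

section Modulus

variable {A : Type*} [ConditionallyCompleteLattice A] [CommRing A] [Algebra ℝ A] [IsFAlgebra A]

instance Cplx.instCommRing : CommRing (Cplx A) where
  mul_comm _ _ := by ext <;> simp <;> ring

theorem cos_smul_le {θ : ℝ} (x : A) : Real.cos θ • x ≤ |x| := by
  have h1 : |Real.cos θ| ≤ 1 := Real.abs_cos_le_one θ
  have h0 := abs_nonneg x
  have h2 : |Real.cos θ| • |x| ≤ |x| := by
    simpa using smul_le_smul_of_nonneg_right h1 h0
  refine le_trans ?_ h2
  rcases le_total 0 (Real.cos θ) with h | h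
  · rw [abs_of_nonneg h]; exact smul_le_smul_of_nonneg_left (le_abs_self x) h
  · rw [abs_of_nonpos h]
    have := smul_le_smul_of_nonneg_left (neg_le_abs x) (neg_nonneg.2 h)
    simpa using this

theorem sin_smul_le {θ : ℝ} (x : A) : Real.sin θ • x ≤ |x| := by
  rw [← Real.cos_pi_div_two_sub]; exact cos_smul_le x

namespace Cplx

theorem le_modulus (z : Cplx A) (θ : ℝ) :
    Real.cos θ • z.re + Real.sin θ • z.im ≤ z.modulus := by
  have hb : BddAbove ((fun θ : ℝ => Real.cos θ • z.re + Real.sin θ • z.im) ''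
      Set.Icc 0 (2 * Real.pi)) :=
    ⟨|z.re| + |z.im|, by
      rintro _ ⟨θ, -, rfl⟩; exact add_le_add (cos_smul_le _) (sin_smul_le _)⟩
  have hper : Function.Periodic (fun θ : ℝ => Real.cos θ • z.re + Real.sin θ • z.im)
      (2 * Real.pi) := fun θ => by simp
  obtain ⟨φ, hφ, h⟩ := hper.exists_mem_Ico₀ Real.two_pi_pos θ
  exact h.trans_le (le_csSup hb ⟨φ, Set.Ico_subset_Icc_self hφ, rfl⟩)

theorem re_le_modulus (z : Cplx A) : z.re ≤ z.modulus := by simpa using le_modulus z 0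

theorem im_le_modulus (z : Cplx A) : z.im ≤ z.modulus := by
  simpa using le_modulus z (Real.pi / 2)

theorem neg_re_le_modulus (z : Cplx A) : -z.re ≤ z.modulus := by
  simpa using le_modulus z Real.pi

theorem modulus_nonneg (z : Cplx A) : 0 ≤ z.modulus := by
  have h := add_le_add (re_le_modulus z) (neg_re_le_modulus z)
  have h2 : (0 : A) ≤ (2 : ℝ) • z.modulus := by rw [two_smul]; simpa using h
  have := smul_nonneg (show (0 : ℝ) ≤ 2⁻¹ by norm_num) h2
  simpa [smul_smul] using this

theorem modulus_add_le (z w : Cplx A) : (z + w).modulus ≤ z.modulus + w.modulus :=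
  modulus_le fun θ => by
    refine le_trans (le_of_eq ?_) (add_le_add (le_modulus z θ) (le_modulus w θ))
    simp only [add_re, add_im]; module

theorem modulus_neg_le (z : Cplx A) : (-z).modulus ≤ z.modulus :=
  modulus_le fun θ => by
    refine le_trans (le_of_eq ?_) (le_modulus z (θ + Real.pi))
    simp

theorem modulus_sub_comm (z w : Cplx A) : (z - w).modulus = (w - z).modulus :=
  le_antisymm (by simpa using modulus_neg_le (w - z)) (by simpa using modulus_neg_le (z - w))

theorem modulus_sub_le (z w : Cplx A) : (z - w).modulus ≤ z.modulus + w.modulus := by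
  rw [sub_eq_add_neg]
  exact (modulus_add_le _ _).trans (add_le_add_right (modulus_neg_le w) _)

theorem modulus_sub_le_add (x y z : Cplx A) :
    (x - z).modulus ≤ (x - y).modulus + (y - z).modulus := by
  simpa using modulus_add_le (x - y) (y - z)

theorem modulus_ofReal_le {x : A} (hx : 0 ≤ x) : (ofReal x).modulus ≤ x :=
  modulus_le fun θ => by
    simpa [ofReal, abs_of_nonneg hx] using cos_smul_le (θ := θ) x

theorem modulus_zero : (0 : Cplx A).modulus = 0 :=
  le_antisymm (modulus_ofReal_le le_rfl) (modulus_nonneg _)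

theorem mul_self_le_mul_self_of_abs_le {x y : A} (h1 : x ≤ y) (h2 : -x ≤ y) : x * x ≤ y * y := by
  have := mul_nonneg (sub_nonneg.2 h1) (sub_nonneg.2 h2)
  refine sub_nonneg.1 (this.trans_eq ?_)
  ring

/-- Squaring `f + ig` improves the constant. Squaring the hypothesis at the half angle shows that
`(f² - g², 2fg)` satisfies the same hypothesis with bound `Q = 2p² - R`, where `R = f² + g²`, and
its own sum of squares is `R²`. Induction gives `R ≤ (1 + η/2) Q`; solving for `R` halves the excess
`η`. The start, with factor 2, only needs `±f, ±g ≤ p`. -/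
theorem normSq_le_of_forall (n : ℕ) : ∀ {f g p : A},
    (∀ θ : ℝ, Real.cos θ • f + Real.sin θ • g ≤ p) →
    f * f + g * g ≤ (1 + (1 / 2 : ℝ) ^ n) • (p * p) := by
  induction n with
  | zero =>
    intro f g p h
    have h1 : f ≤ p := by simpa using h 0
    have h2 : -f ≤ p := by simpa using h Real.pi
    have h3 : g ≤ p := by simpa using h (Real.pi / 2)
    have h4 : -g ≤ p := by simpa using h (-(Real.pi / 2))
    refine (add_le_add (mul_self_le_mul_self_of_abs_le h1 h2)
      (mul_self_le_mul_self_of_abs_le h3 h4)).trans (le_of_eq ?_)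
    norm_num [two_smul]
  | succ n ih =>
    intro f g p h
    set η : ℝ := (1 / 2 : ℝ) ^ n with hη
    have hη0 : 0 < η := by positivity
    set R := f * f + g * g with hR
    set Q := (2 : ℝ) • (p * p) - R with hQ
    have h1 : ∀ θ : ℝ, Real.cos θ • (f * f - g * g) + Real.sin θ • ((2 : ℝ) • (f * g)) ≤ Q := by
      intro θ
      have hs := mul_self_le_mul_self_of_abs_le (h (θ / 2)) ((le_of_eq (by
        rw [Real.cos_add_pi, Real.sin_add_pi]; module)).trans (h (θ / 2 + Real.pi)))
      have hc : Real.cos θ = 2 * Real.cos (θ / 2) ^ 2 - 1 := by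
        rw [← Real.cos_two_mul]; congr 1; ring
      have hc' : Real.cos θ = 1 - 2 * Real.sin (θ / 2) ^ 2 := by
        have := Real.sin_sq_add_cos_sq (θ / 2); linarith
      have hsn : Real.sin θ = 2 * Real.sin (θ / 2) * Real.cos (θ / 2) := by
        rw [← Real.sin_two_mul]; congr 1; ring
      have hs2 := smul_le_smul_of_nonneg_left hs (show (0 : ℝ) ≤ 2 by norm_num)
      rw [hQ, hR, le_sub_iff_add_le]
      refine le_trans (le_of_eq ?_) hs2
      have e : Real.cos θ • (f * f - g * g) =
          (2 * Real.cos (θ / 2) ^ 2 - 1) • (f * f) - (1 - 2 * Real.sin (θ / 2) ^ 2) • (g * g) := by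
        rw [← hc, ← hc', smul_sub]
      rw [e, hsn]
      simp only [Algebra.smul_def, map_sub, map_mul, map_pow, map_one, map_ofNat]
      ring
    have hQ0 : 0 ≤ Q := by
      have a := h1 0
      have b := h1 Real.pi
      simp only [Real.cos_zero, Real.sin_zero, Real.cos_pi, Real.sin_pi, one_smul, zero_smul,
        add_zero, neg_smul] at a b
      have h2 : (0 : A) ≤ (2 : ℝ) • Q := by rw [two_smul]; simpa using add_le_add a b
      have := smul_nonneg (show (0 : ℝ) ≤ 2⁻¹ by norm_num) h2
      simpa [smul_smul] using this
    have h2 := ih h1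
    have h3 : R * R ≤ ((1 + η / 2) • Q) * ((1 + η / 2) • Q) := by
      calc R * R = (f * f - g * g) * (f * f - g * g)
            + ((2 : ℝ) • (f * g)) * ((2 : ℝ) • (f * g)) := by
            rw [hR, two_smul]; ring
        _ ≤ (1 + η) • (Q * Q) := h2
        _ ≤ ((1 + η / 2) * (1 + η / 2)) • (Q * Q) :=
            smul_le_smul_of_nonneg_right (by nlinarith) (mul_nonneg hQ0 hQ0)
        _ = _ := by rw [smul_mul_smul_comm]
    have h4 := le_of_mul_self_le_mul_self (smul_nonneg (by positivity) hQ0) h3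
    have h5 : (2 + η / 2) • R ≤ (2 + η) • (p * p) := by
      have := add_le_add_left h4 ((1 + η / 2) • R)
      refine le_trans (le_of_eq ?_) (this.trans (le_of_eq ?_))
      · module
      · rw [hQ]; module
    have hpp := IsFAlgebra.mul_self_nonneg p
    have h6 := smul_le_smul_of_nonneg_left h5 (show 0 ≤ (2 + η / 2)⁻¹ by positivity)
    rw [smul_smul, inv_mul_cancel₀ (by positivity), one_smul, smul_smul] at h6
    refine h6.trans (smul_le_smul_of_nonneg_right ?_ hpp)
    rw [inv_mul_le_iff₀ (by positivity), pow_succ, ← hη]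
    nlinarith

theorem normSq_le {f g p : A} (h : ∀ θ : ℝ, Real.cos θ • f + Real.sin θ • g ≤ p) :
    f * f + g * g ≤ p * p := by
  refine sub_nonpos.1 (nonpos_of_forall_le_smul (y := p * p) fun ε hε => ?_)
  obtain ⟨n, hn⟩ := exists_pow_lt_of_lt_one hε (show (1 / 2 : ℝ) < 1 by norm_num)
  have h1 := normSq_le_of_forall n h
  rw [add_smul, one_smul] at h1
  exact (sub_le_iff_le_add'.2 h1).trans
    (smul_le_smul_of_nonneg_right hn.le (IsFAlgebra.mul_self_nonneg p))

theorem modulus_mul_le (z w : Cplx A) : (z * w).modulus ≤ z.modulus * w.modulus := by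
  refine modulus_le fun θ => le_of_mul_self_le_mul_self
    (mul_nonneg (modulus_nonneg z) (modulus_nonneg w)) ?_
  have hz := normSq_le (le_modulus z)
  have hw := normSq_le (le_modulus w)
  set f := z.re
  set g := z.im
  set h := w.re
  set k := w.im
  have hfg : 0 ≤ f * f + g * g :=
    add_nonneg (IsFAlgebra.mul_self_nonneg f) (IsFAlgebra.mul_self_nonneg g)
  have hhk : 0 ≤ h * h + k * k :=
    add_nonneg (IsFAlgebra.mul_self_nonneg h) (IsFAlgebra.mul_self_nonneg k)
  have hcs : algebraMap ℝ A (Real.sin θ) ^ 2 + algebraMap ℝ A (Real.cos θ) ^ 2 = 1 := by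
    rw [← map_pow, ← map_pow, ← map_add, Real.sin_sq_add_cos_sq, map_one]
  have key := mul_le_mul hz hw hhk (mul_nonneg (modulus_nonneg z) (modulus_nonneg z))
  -- This is the square of the imaginary part of `e^{-iθ} z w`; with that of the real part it adds
  -- up to `(f² + g²)(h² + k²)`.
  have hs := IsFAlgebra.mul_self_nonneg
    (Real.cos θ • (f * k + g * h) - Real.sin θ • (f * h - g * k))
  refine le_trans (le_add_of_nonneg_right hs) (le_trans (le_of_eq ?_) (key.trans (le_of_eq ?_)))
  · simp only [mul_re, mul_im, Algebra.smul_def]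
    linear_combination ((f * h - g * k) ^ 2 + (f * k + g * h) ^ 2) * hcs
  · ring

theorem modulus_pow_le {z : Cplx A} {r : A} (h : z.modulus ≤ r) (n : ℕ) :
    (z ^ n).modulus ≤ r ^ n := by
  have hr : 0 ≤ r := (modulus_nonneg z).trans h
  induction n with
  | zero => rw [pow_zero, pow_zero]; exact modulus_ofReal_le zero_le_one
  | succ n ih =>
    rw [pow_succ, pow_succ]
    exact (modulus_mul_le _ _).trans (mul_le_mul ih h (modulus_nonneg z) (pow_nonneg hr n))

end Cplx

end Modulus

/-! ### Order completeness of the complexification. -/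

section Limits

variable {A : Type*} [ConditionallyCompleteLattice A] [CommRing A] [Algebra ℝ A] [IsFAlgebra A]

theorem exists_limit_of_cauchy {y q : ℕ → A}
    (h1 : ∀ N M, N ≤ M → y N - y M ≤ q N) (h2 : ∀ N M, N ≤ M → y M - y N ≤ q N) :
    ∃ l, ∀ N, y N - l ≤ q N ∧ l - y N ≤ q N := by
  have h : ∀ N M, y N - q N ≤ y M + q M := fun N M => by
    have a := sub_le_comm.1 (h1 N (max N M) (le_max_left _ _))
    have b := sub_le_iff_le_add'.1 (h2 M (max N M) (le_max_right _ _))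
    exact a.trans b
  have hb : BddAbove (Set.range fun N => y N - q N) :=
    ⟨y 0 + q 0, by rintro _ ⟨N, rfl⟩; exact h N 0⟩
  refine ⟨sSup (Set.range fun N => y N - q N), fun N => ⟨?_, ?_⟩⟩
  · exact sub_le_comm.1 (le_csSup hb ⟨N, rfl⟩)
  · refine sub_le_iff_le_add'.2 (csSup_le (Set.range_nonempty _) ?_)
    rintro _ ⟨M, rfl⟩
    exact h M N

/-- The complexification is complete for convergence in order. -/
theorem Cplx.exists_limit_of_cauchy {x : ℕ → Cplx A} {q : ℕ → A} (hq : DecreasesToZero q)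
    (h : ∀ N M, N ≤ M → (x M - x N).modulus ≤ q N) :
    ∃ l, ∀ N, (x N - l).modulus ≤ q N := by
  have h' : ∀ N M, N ≤ M → (x N - x M).modulus ≤ q N := fun N M hNM => by
    rw [modulus_sub_comm]; exact h N M hNM
  obtain ⟨l₁, hl₁⟩ := VLSeries.exists_limit_of_cauchy (y := fun n => (x n).re) (q := q)
    (fun N M hNM => (re_le_modulus _).trans (h' N M hNM))
    (fun N M hNM => (re_le_modulus _).trans (h N M hNM))
  obtain ⟨l₂, hl₂⟩ := VLSeries.exists_limit_of_cauchy (y := fun n => (x n).im) (q := q)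
    (fun N M hNM => (im_le_modulus _).trans (h' N M hNM))
    (fun N M hNM => (im_le_modulus _).trans (h N M hNM))
  refine ⟨⟨l₁, l₂⟩, fun N => modulus_le fun θ => sub_nonpos.1 ?_⟩
  -- Componentwise limits alone would lose a factor. Passing through a later term `x K` costs `2 * q
  -- M`, and `M` is arbitrary.
  refine (hq.mul_left (c := 2) zero_le_two).2.2 ?_
  rintro _ ⟨M, rfl⟩
  set K := max N M
  have hK : q K ≤ q M := hq.1 (le_max_right _ _)
  have e1 := (le_modulus (x N - x K) θ).trans (h' N K (le_max_left _ _))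
  have e2 : Real.cos θ • ((x K).re - l₁) ≤ q K :=
    (cos_smul_le _).trans (abs_le'.2 ⟨(hl₁ K).1, by simpa using (hl₁ K).2⟩)
  have e3 : Real.sin θ • ((x K).im - l₂) ≤ q K :=
    (sin_smul_le _).trans (abs_le'.2 ⟨(hl₂ K).1, by simpa using (hl₂ K).2⟩)
  refine sub_le_iff_le_add'.2 (le_trans (le_of_eq ?_)
    (add_le_add e1 ((add_le_add e2 e3).trans ((add_le_add hK hK).trans_eq (two_mul _).symm))))
  simp only [sub_re, sub_im]
  module

end Limits

/-! ### Abel summation and the passage to the limit. -/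

section PowerSeries

open Cplx

variable {A : Type*} [ConditionallyCompleteLattice A] [CommRing A] [Algebra ℝ A] [IsFAlgebra A]

theorem Cplx.ofReal_mul {A : Type*} [Ring A] (x y : A) : ofReal (x * y) = ofReal x * ofReal y := by
  ext <;> simp [ofReal]

theorem partialSum_succ {A : Type*} [Ring A] (a : ℕ → Cplx A) (z : Cplx A) (m : ℕ) :
    partialSum a z (m + 1) = partialSum a z m + a (m + 1) * z ^ (m + 1) :=
  Finset.sum_range_succ _ _

/-- The negative part of `y - x` is disjoint from the positive part, a weak order unit, and so
vanishes. -/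
theorem MuchLess.isWeakOrderUnit_sub {x y : A} (h : MuchLess x y) : IsWeakOrderUnit (y - x) := by
  have h0 : (y - x)⁻ = 0 := by
    refine h.2 _ ?_
    rw [abs_of_nonneg (negPart_nonneg _), inf_comm]
    exact posPart_inf_negPart_eq_zero _
  have h1 : (y - x) ⊔ 0 = y - x := by
    have := posPart_sub_negPart (y - x)
    rwa [h0, sub_zero] at this
  exact h1 ▸ h

/-- Summation by parts: on a Stolz region the partial sums are uniformly Cauchy. -/
theorem modulus_partialSum_sub_le {a : ℕ → Cplx A} {r z t s : Cplx A} {τ K : A} {p : ℕ → A}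
    (hp : Antitone p) (hp0 : ∀ n, 0 ≤ p n) (hs : ∀ n, (partialSum a r n - s).modulus ≤ p n)
    (hz : z = r * t) (hK : 0 ≤ K) (ht : t.modulus ≤ τ) (hτ : τ ≤ 1)
    (hstolz : (1 - t).modulus ≤ K * (1 - τ)) {N M : ℕ} (hNM : N ≤ M) :
    (partialSum a z M - partialSum a z N).modulus ≤ (2 + K) * p N := by
  have hτ0 : 0 ≤ τ := (modulus_nonneg t).trans ht
  have hpow : ∀ n, τ ^ n ≤ 1 := fun n => pow_le_one₀ hτ0 hτ
  set D : ℕ → Cplx A := fun n => partialSum a r n - s with hD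
  -- Removing the boundary term leaves increments `D n * t ^ n * (1 - t)`. The Stolz bound makes
  -- them telescope against `τ ^ n - τ ^ (n + 1)`, so `1 - τ` is never inverted. The total gives the
  -- `K` in `2 + K`; the two boundary terms give the 2.
  set F : ℕ → Cplx A := fun n => partialSum a z n - D n * t ^ n with hF
  have hDt : ∀ n, N ≤ n → (D n * t ^ n).modulus ≤ p N * τ ^ n := fun n hn =>
    (modulus_mul_le _ _).trans (mul_le_mul ((hs n).trans (hp hn)) (modulus_pow_le ht n)
      (modulus_nonneg _) (hp0 N))
  have hDt' : ∀ n, N ≤ n → (D n * t ^ n).modulus ≤ p N := fun n hn =>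
    (hDt n hn).trans (mul_le_of_le_one_right (hp0 N) (hpow n))
  have hstep : ∀ n, F (n + 1) - F n = D n * t ^ n * (1 - t) := fun n => by
    simp only [hF, hD, partialSum_succ, hz]; ring
  have hFN : ∀ n, N ≤ n → (F n - F N).modulus ≤ K * p N * (τ ^ N - τ ^ n) := by
    intro n hn
    induction n, hn using Nat.le_induction with
    | base => simp [modulus_zero]
    | succ n hn ih =>
      have h1 : (F (n + 1) - F n).modulus ≤ p N * τ ^ n * (K * (1 - τ)) := by
        rw [hstep]
        exact (modulus_mul_le _ _).trans (mul_le_mul (hDt n hn) hstolz (modulus_nonneg _)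
          (mul_nonneg (hp0 N) (pow_nonneg hτ0 n)))
      refine (modulus_sub_le_add _ (F n) _).trans ((add_le_add h1 ih).trans (le_of_eq ?_))
      ring
  have h2 : (F M - F N).modulus ≤ K * p N :=
    (hFN M hNM).trans (mul_le_of_le_one_right (mul_nonneg hK (hp0 N))
      ((sub_le_self _ (pow_nonneg hτ0 M)).trans (hpow N)))
  have e : partialSum a z M - partialSum a z N
      = (F M - F N) + (D M * t ^ M - D N * t ^ N) := by
    simp only [hF]; ring
  rw [e]
  refine (modulus_add_le _ _).trans ((add_le_add h2 ((modulus_sub_le _ _).trans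
    (add_le_add (hDt' M hNM) (hDt' N le_rfl)))).trans (le_of_eq ?_))
  ring

theorem exists_modulus_pow_sub_le {ρ : A} {c : Cplx A} (hc : c.modulus ≤ ρ) (n : ℕ) :
    ∃ Q : A, 0 ≤ Q ∧ ∀ w : Cplx A, w.modulus ≤ ρ →
      (w ^ n - c ^ n).modulus ≤ Q * (w - c).modulus := by
  have hρ : 0 ≤ ρ := (modulus_nonneg c).trans hc
  induction n with
  | zero => exact ⟨0, le_rfl, fun w _ => by simp [modulus_zero]⟩
  | succ n ih =>
    obtain ⟨Q, hQ0, hQ⟩ := ih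
    refine ⟨Q * ρ + ρ ^ n, add_nonneg (mul_nonneg hQ0 hρ) (pow_nonneg hρ n), fun w hw => ?_⟩
    have e : w ^ (n + 1) - c ^ (n + 1) = (w ^ n - c ^ n) * w + c ^ n * (w - c) := by ring
    rw [e]
    refine (modulus_add_le _ _).trans ((add_le_add
      ((modulus_mul_le _ _).trans (mul_le_mul (hQ w hw) hw (modulus_nonneg _)
        (mul_nonneg hQ0 (modulus_nonneg _))))
      ((modulus_mul_le _ _).trans (mul_le_mul_of_nonneg_right (modulus_pow_le hc n)
        (modulus_nonneg _)))).trans (le_of_eq ?_))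
    ring

/-- Polynomials are Lipschitz on order balls. -/
theorem exists_modulus_partialSum_sub_le (a : ℕ → Cplx A) {ρ : A} {c : Cplx A}
    (hc : c.modulus ≤ ρ) (m : ℕ) :
    ∃ Q : A, 0 ≤ Q ∧ ∀ w : Cplx A, w.modulus ≤ ρ →
      (partialSum a w m - partialSum a c m).modulus ≤ Q * (w - c).modulus := by
  induction m with
  | zero => exact ⟨0, le_rfl, fun w _ => by simp [partialSum, modulus_zero]⟩
  | succ m ih =>
    obtain ⟨Q, hQ0, hQ⟩ := ih
    obtain ⟨R, hR0, hR⟩ := exists_modulus_pow_sub_le hc (m + 1)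
    refine ⟨Q + (a (m + 1)).modulus * R,
      add_nonneg hQ0 (mul_nonneg (modulus_nonneg _) hR0), fun w hw => ?_⟩
    have e : partialSum a w (m + 1) - partialSum a c (m + 1) =
        (partialSum a w m - partialSum a c m) + a (m + 1) * (w ^ (m + 1) - c ^ (m + 1)) := by
      rw [partialSum_succ, partialSum_succ]; ring
    rw [e]
    refine (modulus_add_le _ _).trans ((add_le_add (hQ w hw) ((modulus_mul_le _ _).trans
      (mul_le_mul_of_nonneg_left (hR w hw) (modulus_nonneg _)))).trans (le_of_eq ?_))
    ring

/-- A double limit: if `x k ≤ p m + Q m * q k` for all `m`, then `x k` is dominated by a sequence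
decreasing to zero. -/
theorem exists_decreasesToZero_of_le_add_mul {p q Q : ℕ → A} (hp : DecreasesToZero p)
    (hq : DecreasesToZero q) (hQ : ∀ m, 0 ≤ Q m) :
    ∃ r : ℕ → A, DecreasesToZero r ∧ ∀ k b, (∀ m, b ≤ p m + Q m * q k) → b ≤ r k := by
  have h0 : ∀ k m, 0 ≤ p m + Q m * q k := fun k m =>
    add_nonneg (hp.nonneg m) (mul_nonneg (hQ m) (hq.nonneg k))
  have hb : ∀ k, BddBelow (Set.range fun m => p m + Q m * q k) := fun k =>
    ⟨0, by rintro _ ⟨m, rfl⟩; exact h0 k m⟩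
  have hle : ∀ k b, (∀ m, b ≤ p m + Q m * q k) →
      b ≤ sInf (Set.range fun m => p m + Q m * q k) := fun k b h =>
    le_csInf (Set.range_nonempty _) (by rintro _ ⟨m, rfl⟩; exact h m)
  -- To see that the infimum is `0`, let `k` vary first with `m` fixed, which leaves `p m`, and only
  -- then `m`.
  refine ⟨fun k => sInf (Set.range fun m => p m + Q m * q k), ⟨?_, ?_, ?_⟩, hle⟩
  · intro k l hkl
    refine hle k _ fun m => (csInf_le (hb l) ⟨m, rfl⟩).trans ?_
    exact add_le_add_right (mul_le_mul_of_nonneg_left (hq.1 hkl) (hQ m)) _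
  · rintro _ ⟨k, rfl⟩
    exact hle k 0 (h0 k)
  · intro w hw
    refine hp.2.2 ?_
    rintro _ ⟨m, rfl⟩
    refine sub_nonpos.1 ((hq.mul_left (hQ m)).2.2 ?_)
    rintro _ ⟨k, rfl⟩
    exact sub_le_iff_le_add'.2 ((hw ⟨k, rfl⟩).trans (csInf_le (hb k) ⟨m, rfl⟩))

theorem exists_stolz_bound [IsLaterallyComplete A] {ρ : A} {z : ℕ → Cplx A}
    (hlt : ∀ k, MuchLess (z k).modulus ρ)
    (hbdd : IsOrderBounded (Set.range fun k =>
      (ofReal ρ - z k).modulus * Ring.inverse (ρ - (z k).modulus))) :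
    ∃ K : A, 0 ≤ K ∧ ∀ k, (ofReal ρ - z k).modulus ≤ K * (ρ - (z k).modulus) := by
  obtain ⟨_, K, hK⟩ := hbdd
  refine ⟨K ⊔ 0, le_sup_right, fun k => ?_⟩
  have hu := (hlt k).isWeakOrderUnit_sub
  obtain ⟨v, -, hv⟩ := hu.exists_mul_eq_one
  have hinv := Ring.inverse_mul_cancel _ (IsUnit.of_mul_eq_one v hv)
  have h := mul_le_mul_of_nonneg_right ((hK ⟨k, rfl⟩).2.trans le_sup_left : _ ≤ K ⊔ 0) hu.1
  simp only [] at h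
  rwa [mul_assoc, hinv, mul_one] at h

/-- Abel's theorem in a commutative universally complete `Φ`-algebra. -/
theorem abel_of_commRing [IsLaterallyComplete A] (a : ℕ → Cplx A) (ρ : A)
    (hρu : IsWeakOrderUnit ρ) (s : Cplx A) (hs : HasOrderSum a (ofReal ρ) s)
    (z : ℕ → Cplx A) (hz : OrderTendsto z (ofReal ρ))
    (hlt : ∀ k, MuchLess (z k).modulus ρ)
    (hbdd : IsOrderBounded (Set.range fun k =>
      (ofReal ρ - z k).modulus * Ring.inverse (ρ - (z k).modulus))) :
    ∃ σ : ℕ → Cplx A, (∀ k, HasOrderSum a (z k) (σ k)) ∧ OrderTendsto σ s := by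
  obtain ⟨p, hp, hs⟩ := hs
  obtain ⟨q, hq, hz⟩ := hz
  obtain ⟨K, hK0, hK⟩ := exists_stolz_bound hlt hbdd
  obtain ⟨v, hv0, hv⟩ := hρu.exists_mul_eq_one
  have hzρ : ∀ k, (z k).modulus ≤ ρ := fun k => sub_nonneg.1 (hlt k).isWeakOrderUnit_sub.1
  have hvρ : ofReal ρ * ofReal v = 1 := by rw [← Cplx.ofReal_mul, hv]; rfl
  have hC0 : 0 ≤ 2 + K := add_nonneg zero_le_two hK0
  have hCp := hp.mul_left hC0
  have hcauchy : ∀ k N M, N ≤ M →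
      (partialSum a (z k) M - partialSum a (z k) N).modulus ≤ (2 + K) * p N := by
    intro k N M hNM
    refine modulus_partialSum_sub_le (t := z k * ofReal v) (τ := (z k).modulus * v) hp.1
      hp.nonneg hs ?_ hK0 ?_ ?_ ?_ hNM
    · linear_combination -(z k) * hvρ
    · exact (modulus_mul_le _ _).trans
        (mul_le_mul_of_nonneg_left (modulus_ofReal_le hv0) (modulus_nonneg _))
    · exact (mul_le_mul_of_nonneg_right (hzρ k) hv0).trans_eq hv
    · have e : 1 - z k * ofReal v = (ofReal ρ - z k) * ofReal v := by
        linear_combination -hvρ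
      rw [e]
      refine (modulus_mul_le _ _).trans ((mul_le_mul (hK k) (modulus_ofReal_le hv0)
        (modulus_nonneg _) ((modulus_nonneg _).trans (hK k))).trans (le_of_eq ?_))
      linear_combination K * hv
  choose σ hσ using fun k => Cplx.exists_limit_of_cauchy hCp (hcauchy k)
  have hρρ : (ofReal ρ).modulus ≤ ρ := modulus_ofReal_le hρu.1
  choose Q hQ0 hQ using exists_modulus_partialSum_sub_le a hρρ
  -- The coefficient `(2 + K) + 1` collects the tail at `z k` and the tail at `ρ`; the Lipschitz
  -- term between them is `Q m * q k`.
  obtain ⟨r, hr, hle⟩ := exists_decreasesToZero_of_le_add_mul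
    (hp.mul_left (add_nonneg hC0 zero_le_one)) hq hQ0
  refine ⟨σ, fun k => ⟨_, hCp, hσ k⟩, r, hr, fun k => hle k _ fun m => ?_⟩
  have h1 : (σ k - partialSum a (z k) m).modulus ≤ (2 + K) * p m := by
    rw [modulus_sub_comm]; exact hσ k m
  have h2 : (partialSum a (z k) m - partialSum a (ofReal ρ) m).modulus ≤ Q m * q k :=
    (hQ m _ (hzρ k)).trans (mul_le_mul_of_nonneg_left (hz k) (hQ0 m))
  refine (modulus_sub_le_add _ (partialSum a (z k) m) _).trans ((add_le_add h1
    ((modulus_sub_le_add _ (partialSum a (ofReal ρ) m) _).trans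
      (add_le_add h2 (hs m)))).trans (le_of_eq ?_))
  ring

end PowerSeries

end VLSeries

/-- Here `Cplx A` is a universally complete complex vector lattice with real part `A`.  The
assumption `|z k| ≪ ρ` makes `ρ - |z k|` invertible, so that `Ring.inverse` is its inverse. -/
theorem mainTheorem6 {A : Type*} [ConditionallyCompleteLattice A] [Ring A] [Algebra ℝ A]
    [IsFAlgebra A] [IsLaterallyComplete A]
    (a : ℕ → Cplx A) (ρ : A) (hρ : HasRadiusOfConvergence a ρ) (hρu : IsWeakOrderUnit ρ)
    (s : Cplx A) (hs : HasOrderSum a (Cplx.ofReal ρ) s)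
    (z : ℕ → Cplx A) (hz : OrderTendsto z (Cplx.ofReal ρ))
    (hlt : ∀ k, MuchLess (z k).modulus ρ)
    (hbdd : IsOrderBounded (Set.range fun k =>
      (Cplx.ofReal ρ - z k).modulus * Ring.inverse (ρ - (z k).modulus))) :
    ∃ σ : ℕ → Cplx A, (∀ k, HasOrderSum a (z k) (σ k)) ∧ OrderTendsto σ s := by
  -- Only commutativity is added to the given ring structure, so the operations on `Cplx A` remain
  -- the same.
  let _ : CommRing A := { ‹Ring A› with mul_comm := IsFAlgebra.mul_comm' }
  exact abel_of_commRing a ρ hρu s hs z hz hlt hbdd
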